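/- **Theorem 1.** Consider a finite game: finitely many players, player $j$ having a finite non-empty set $S_j$ of pure strategies, and let $i$ be a player with payoff function $u_i : \prod_j S_j \to [-1,1]$. The game is played repeatedly at times $t = 1, 2, \dots$; $s_t = (s_{t,j})_j$ denotes the profile played at time $t$ and $s_{t,-i}$ the moves of the players other than $i$. The opponents of $i$ are arbitrary and possibly adaptive: $s_{t,-i}$ may depend on everything that happened before time $t$ and on private randomness of the opponents. Player $i$ uses *sampled fictitious play with Bernoulli sampling*: at each time $t$ she draws fresh i.i.d. signs $\epsilon^{(t)}_1, \dots, \epsilon^{(t)}_{t-1}$ with $P(\epsilon^{(t)}_\tau = +1) = P(\epsilon^{(t)}_\tau = -1) = \tfrac12$, independent of everything that happened before time $t$, of the private randomness of the opponents and of $s_{t,-i}$; she puts $\mathbb{S}_t = \{\tau \in \{1,\dots,t-1\} : \epsilon^{(t)}_\tau = +1\}$ and plays $$ s_{t,i} \in \arg\max_{k \in S_i} \sum_{\tau \in \mathbb{S}_t} u_i(k, s_{\tau,-i}), $$ ties being broken uniformly at random and independently of all previous randomness (including that of the opponents, and of $s_{t,-i}$); if $\mathbb{S}_t = \emptyset$,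 the argmax is all of $S_i$. Let $$ \mathcal{R}_T = \max_{k \in S_i} \sum_{t=1}^T u_i(k, s_{t,-i}) - \sum_{t=1}^T u_i(s_t) $$ be the regret of player $i$. Then player $i$'s procedure is Hannan consistent: $$ \limsup_{T \to \infty} \frac{\mathcal{R}_T}{T} \le 0 \quad \text{almost surely.} $$ -/

import Mathlib

open MeasureTheory ProbabilityTheory Filter

namespace RepeatedGame

/-- `cumPayoff v i s A k = ∑ τ ∈ A, v (k, s_{τ,-i})`: the total payoff that player `i`, whose payoff
function is `v`, would have got over the rounds in `A` by playing `k` in each of them, the moves of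
the other players being those of the sequence of plays `s`. -/
def cumPayoff {ι : Type*} [DecidableEq ι] {S : ι → Type*} (v : (∀ j, S j) → ℝ) (i : ι)
    (s : ℕ → ∀ j, S j) (A : Finset ℕ) (k : S i) : ℝ :=
  ∑ τ ∈ A, v (Function.update (s τ) i k)

/-- Regret of player `i` after `T` rounds. Rounds are numbered `0, 1, 2, …`, so the first `T` rounds
are those in `Finset.range T`. -/
noncomputable def regret {ι : Type*} [DecidableEq ι] {S : ι → Type*} (v : (∀ j, S j) → ℝ) (i : ι)
    [Fintype (S i)] [Nonempty (S i)] (s : ℕ → ∀ j, S j) (T : ℕ) : ℝ :=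
  (Finset.univ.sup' Finset.univ_nonempty fun k : S i => cumPayoff v i s (Finset.range T) k)
    - ∑ τ ∈ Finset.range T, v (s τ)

open Classical in
/-- The set `argmax_k ∑ τ ∈ A, v (k, s_{τ,-i})` of best responses to the moves of the other players
in the rounds in `A` (all of `S i` if `A` is empty). -/
noncomputable def bestResponses {ι : Type*} [DecidableEq ι] {S : ι → Type*} (v : (∀ j, S j) → ℝ)
    (i : ι) [Fintype (S i)] (s : ℕ → ∀ j, S j) (A : Finset ℕ) : Finset (S i) :=
  {k | ∀ k' : S i, cumPayoff v i s A k' ≤ cumPayoff v i s A k}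

/-- The sampled set of past rounds `{τ < t | e τ = +1}` given by the signs `e`. -/
def sampledSet (t : ℕ) (e : ℕ → ℤ) : Finset ℕ :=
  {τ ∈ Finset.range t | e τ = 1}

/-- The σ-algebra generated by the signs `ε t τ`, `τ < t`, drawn in round `t`. -/
abbrev signAlgebra {Ω : Type*} (ε : ℕ → ℕ → Ω → ℤ) (t : ℕ) : MeasurableSpace Ω :=
  ⨆ τ : Fin t, MeasurableSpace.comap (ε t τ) inferInstance

/-- `s` is a random sequence of plays in which the opponents of player `i` are arbitrary, possibly
randomized and adaptive. The σ-algebra `ℱ t` is the information available to the opponents when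
they move in round `t`: it contains all plays of the rounds before `t`, and it may contain
anything else, such as the private randomness of the opponents (of all rounds). The moves of the
opponents in round `t` are any functions of that information. (All moves lie in finite sets, so
measurability is stated on points.) -/
structure IsAdaptivePlay {ι : Type*} {S : ι → Type*} {Ω : Type*} {mΩ : MeasurableSpace Ω} (i : ι)
    (ℱ : Filtration ℕ mΩ) (s : ℕ → Ω → ∀ j, S j) : Prop where
  past : ∀ t, ∀ τ < t, ∀ a : ∀ j, S j, MeasurableSet[ℱ t] {ω | s τ ω = a}
  opponents : ∀ t, ∀ j ≠ i, ∀ a : S j, MeasurableSet[ℱ t] {ω | s t ω j = a}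

/-- In the play `s`, player `i` with payoff function `v` uses sampled fictitious play with
Bernoulli sampling, the signs `ε t τ`, `τ < t`, being drawn afresh in round `t`. -/
structure IsSampledFictitiousPlay {ι : Type*} [DecidableEq ι] {S : ι → Type*} {Ω : Type*}
    {mΩ : MeasurableSpace Ω} (P : Measure Ω) (v : (∀ j, S j) → ℝ) (i : ι) [Fintype (S i)]
    (ℱ : Filtration ℕ mΩ) (ε : ℕ → ℕ → Ω → ℤ) (s : ℕ → Ω → ∀ j, S j) : Prop where
  /-- The signs of round `t` are random variables ... -/
  measurable_sign : ∀ t, ∀ τ < t, Measurable (ε t τ)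
  /-- ... with the symmetric distribution on `{-1, +1}` ... -/
  sign_law : ∀ t, ∀ τ < t, P {ω | ε t τ ω = 1} = 1 / 2 ∧ P {ω | ε t τ ω = -1} = 1 / 2
  /-- ... which are mutually independent ... -/
  sign_indep : ∀ t, iIndepFun (fun τ : Fin t => ε t τ) P
  /-- ... and independent of everything that happened before, of the private randomness of the
  opponents and of their moves in round `t`. -/
  sign_fresh : ∀ t, Indep (signAlgebra ε t) (ℱ t) P
  /-- The signs of the earlier rounds belong to what happened before. -/
  sign_past : ∀ t, ∀ r < t, signAlgebra ε r ≤ ℱ t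
  /-- In round `t` player `i` plays a best response to the moves of the others in the sampled
  rounds, ties being broken uniformly at random and independently of all previous randomness:
  given `ℱ t` and the signs of round `t`, her move is uniform on the set of best responses. -/
  best_response : ∀ t, ∀ k : S i,
    P⟦{ω | s t ω i = k} | ℱ t ⊔ signAlgebra ε t⟧ =ᵐ[P] fun ω =>
      Set.indicator
        (bestResponses v i (fun τ => s τ ω) (sampledSet t fun τ => ε t τ ω) : Set (S i))
        (fun _ =>
          1 / ((bestResponses v i (fun τ => s τ ω) (sampledSet t fun τ => ε t τ ω)).card : ℝ)) k

/-- In the play `s`, player `i` with payoff function `v` almost surely has no regret in the limit. -/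
def HasNoRegret {ι : Type*} [DecidableEq ι] {S : ι → Type*} {Ω : Type*} {mΩ : MeasurableSpace Ω}
    (P : Measure Ω) (v : (∀ j, S j) → ℝ) (i : ι) [Fintype (S i)] [Nonempty (S i)]
    (s : ℕ → Ω → ∀ j, S j) : Prop :=
  ∀ᵐ ω ∂P, limsup (fun T : ℕ => regret v i (fun τ => s τ ω) T / (T : ℝ)) atTop ≤ 0

end RepeatedGame

namespace RepeatedGame

open scoped symmDiff Topology

/-! ### A Littlewood–Offord inequality -/

/-! Fix a payoff sequence `g` and let `A` be a uniformly random subset of the first `T` rounds. The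
potential is twice the mean of the maximal cumulative payoff over `A`. It dominates the best fixed
payoff, since each round lies in `A` with probability 1/2 and a mean of maxima is at least the
maximum of means. When a round is added, the potential grows by at most the expected payoff of
sampled fictitious play, up to an error that occurs only if the new payoffs can reverse the order of
two alternatives (`maxValue_add_le`, `subsetAverage_maxValue_le`).

A reversal forces the random subset sum of past payoff differences into a bounded interval. By
Littlewood–Offord this is unlikely once many past differences exceed a threshold `η`; rounds with a
difference at most `η` cost at most `η` each. So the total error is o(T), uniformly in `g`
(`sum_abs_mul_subsetAverage_le`).

Uniformity makes adaptive opponents harmless: the bound applies pathwise to the realized moves. As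
the signs are fresh, the payoff minus its sampled expectation is a bounded martingale difference
(`condExp_payoff`), and its averages vanish almost surely (`ae_tendsto_sum_div`). -/

theorem mul_centralBinom_sq_le (n : ℕ) : (2 * n + 1) * n.centralBinom ^ 2 ≤ 16 ^ n := by
  induction n with
  | zero => simp
  | succ n ih =>
    refine le_of_mul_le_mul_left ?_ (show 0 < (n + 1) ^ 2 by positivity)
    calc (n + 1) ^ 2 * ((2 * (n + 1) + 1) * (n + 1).centralBinom ^ 2)
        = (2 * n + 3) * ((n + 1) * (n + 1).centralBinom) ^ 2 := by ring
      _ = (4 * ((2 * n + 3) * (2 * n + 1))) * ((2 * n + 1) * n.centralBinom ^ 2) := by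
        rw [Nat.succ_mul_centralBinom_succ]; ring
      -- Here (2n+3)(2n+1) = 4(n+1)² - 1.
      _ ≤ (16 * (n + 1) ^ 2) * 16 ^ n := Nat.mul_le_mul (by nlinarith) ih
      _ = (n + 1) ^ 2 * 16 ^ (n + 1) := by ring

theorem choose_half_div_two_pow_le (n : ℕ) :
    (n.choose (n / 2) : ℝ) / 2 ^ n ≤ (n / 2).centralBinom / 4 ^ (n / 2) := by
  obtain ⟨m, rfl | rfl⟩ := n.even_or_odd'
  · simp [Nat.centralBinom, pow_mul]
    norm_num
  · have h : (2 * m + 1) / 2 = m := by omega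
    rw [h]
    have h2 : (2 * m + 1).choose m ≤ 2 * m.centralBinom := by
      rcases m with _ | m
      · simp
      · rw [Nat.choose_succ_succ']
        have h3 := Nat.choose_le_centralBinom m (m + 1)
        have h4 := Nat.choose_le_centralBinom (m + 1) (m + 1)
        omega
    have h3 : ((2 * m + 1).choose m : ℝ) ≤ 2 * m.centralBinom := by exact_mod_cast h2
    rw [pow_succ, pow_mul, div_le_div_iff₀ (by positivity) (by positivity)]
    norm_num
    nlinarith [pow_pos (show (0 : ℝ) < 4 by norm_num) m]

theorem tendsto_centralBinom_div_four_pow :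
    Tendsto (fun n : ℕ => (n.centralBinom : ℝ) / 4 ^ n) atTop (𝓝 0) := by
  have h1 : Tendsto (fun n : ℕ => Real.sqrt (1 / ((n : ℝ) + 1))) atTop (𝓝 0) := by
    simpa using (tendsto_one_div_add_atTop_nhds_zero_nat (𝕜 := ℝ)).sqrt
  refine squeeze_zero (fun n => by positivity) (fun n => ?_) h1
  apply Real.le_sqrt_of_sq_le
  rw [div_pow, ← pow_mul, mul_comm n 2, pow_mul, div_le_div_iff₀ (by positivity) (by positivity)]
  have := mul_centralBinom_sq_le n
  have h : ((2 * n + 1) * n.centralBinom ^ 2 : ℝ) ≤ 16 ^ n := by exact_mod_cast this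
  norm_num
  nlinarith [sq_nonneg (n.centralBinom : ℝ), (Nat.cast_nonneg n : (0 : ℝ) ≤ n)]

theorem tendsto_choose_half_div_two_pow :
    Tendsto (fun n : ℕ => (n.choose (n / 2) : ℝ) / 2 ^ n) atTop (𝓝 0) :=
  squeeze_zero (fun n => by positivity) choose_half_div_two_pow_le
    (tendsto_centralBinom_div_four_pow.comp (Nat.tendsto_div_const_atTop two_ne_zero))

open Classical in
-- Erdős's argument: enlarging a set raises its sum by at least `η`, the length of the half-open
-- interval, so the sets counted form an antichain and Sperner's theorem applies.
theorem card_finset_sum_abs_mem_Ico_le {α : Type*} [Fintype α] (d : α → ℝ) {η : ℝ}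
    (hd : ∀ a, η ≤ |d a|) (x : ℝ) :
    (Finset.univ.filter fun A : Finset α => ∑ a ∈ A, |d a| ∈ Set.Ico x (x + η)).card
      ≤ (Fintype.card α).choose (Fintype.card α / 2) := by
  refine IsAntichain.sperner fun A hA B hB hne hAB => ?_
  simp only [Finset.coe_filter, Finset.mem_univ, true_and, Set.mem_ofPred_eq, Set.mem_Ico] at hA hB
  obtain ⟨b, hb, hbA⟩ := Finset.exists_of_ssubset (hAB.ssubset_of_ne hne)
  have h1 : ∑ a ∈ insert b A, |d a| ≤ ∑ a ∈ B, |d a| :=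
    Finset.sum_le_sum_of_subset_of_nonneg (Finset.insert_subset hb hAB) fun _ _ _ => abs_nonneg _
  rw [Finset.sum_insert hbA] at h1
  linarith [hd b]

open Classical in
-- Toggling membership of the negative terms shifts every subset sum by one constant, which reduces
-- arbitrary signs to positive weights.
theorem sum_symmDiff_abs {α : Type*} [Fintype α] (d : α → ℝ) (A : Finset α) :
    ∑ a ∈ A ∆ Finset.univ.filter (fun a => d a < 0), |d a|
      = ∑ a ∈ A, d a + ∑ a ∈ Finset.univ.filter (fun a => d a < 0), |d a| := by
  have key (B : Finset α) (f : α → ℝ) : ∑ a ∈ B, f a = ∑ a, if a ∈ B then f a else 0 := by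
    simp [Finset.sum_ite_mem]
  rw [key (A ∆ _), key A, key (Finset.univ.filter _), ← Finset.sum_add_distrib]
  refine Finset.sum_congr rfl fun a _ => ?_
  by_cases h1 : a ∈ A <;> by_cases h2 : d a < 0 <;>
    simp [Finset.mem_symmDiff, h1, h2, abs_of_neg, abs_of_nonneg, not_lt.1]

open Classical in
theorem card_finset_sum_mem_Ico_le {α : Type*} [Fintype α] (d : α → ℝ) {η : ℝ}
    (hd : ∀ a, η ≤ |d a|) (x : ℝ) :
    (Finset.univ.filter fun A : Finset α => ∑ a ∈ A, d a ∈ Set.Ico x (x + η)).card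
      ≤ (Fintype.card α).choose (Fintype.card α / 2) := by
  set N : Finset α := Finset.univ.filter (fun a => d a < 0)
  refine le_trans (Finset.card_le_card_of_injOn (fun A => A ∆ N) (fun A hA => ?_) ?_)
    (card_finset_sum_abs_mem_Ico_le d hd (x + ∑ a ∈ N, |d a|))
  · simp only [Finset.coe_filter, Finset.mem_univ, true_and, Set.mem_ofPred_eq, Set.mem_Ico] at hA ⊢
    rw [sum_symmDiff_abs]
    constructor <;> linarith [hA.1, hA.2]
  · exact (symmDiff_left_injective N).injOn

/-- **Littlewood–Offord inequality**: subset sums of numbers of absolute value at least `η`. -/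
theorem card_powerset_sum_mem_Ico_le (d : ℕ → ℝ) {η : ℝ} (I : Finset ℕ)
    (hd : ∀ a ∈ I, η ≤ |d a|) (x : ℝ)
    [DecidablePred fun A : Finset ℕ => ∑ a ∈ A, d a ∈ Set.Ico x (x + η)] :
    (I.powerset.filter fun A => ∑ a ∈ A, d a ∈ Set.Ico x (x + η)).card
      ≤ I.card.choose (I.card / 2) := by
  classical
  have h := card_finset_sum_mem_Ico_le (fun a : I => d a) (fun a => hd a a.2) x
  rw [Fintype.card_coe] at h
  have hs (A : Finset ℕ) (hA : A ⊆ I) : (A.subtype (· ∈ I)).map (.subtype _) = A :=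
    Finset.subtype_map_of_mem fun a ha => hA ha
  refine le_trans (Finset.card_le_card_of_injOn (fun A => A.subtype (· ∈ I)) (fun A hA => ?_)
    fun A hA B hB hAB => ?_) h
  · simp only [Finset.coe_filter, Finset.mem_powerset, Finset.mem_univ, true_and,
      Set.mem_ofPred_eq] at hA ⊢
    have : ∑ a ∈ A.subtype (· ∈ I), d a = ∑ a ∈ A, d a := by
      conv_rhs => rw [← hs A hA.1, Finset.sum_map]
      rfl
    rw [this]
    exact hA.2
  · simp only [Finset.coe_filter, Finset.mem_powerset, Set.mem_ofPred_eq] at hA hB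
    rw [← hs A hA.1, ← hs B hB.1]
    exact congrArg _ hAB

/-- The mean of `f` over a uniformly random subset of `B`. -/
noncomputable def subsetAverage (B : Finset ℕ) (f : Finset ℕ → ℝ) : ℝ :=
  (∑ A ∈ B.powerset, f A) / 2 ^ B.card

theorem subsetAverage_insert {B : Finset ℕ} {b : ℕ} (hb : b ∉ B) (f : Finset ℕ → ℝ) :
    subsetAverage (insert b B) f
      = (subsetAverage B f + subsetAverage B fun A => f (insert b A)) / 2 := by
  simp only [subsetAverage]
  rw [Finset.sum_powerset_insert hb, Finset.card_insert_of_notMem hb, pow_succ]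
  field_simp

theorem subsetAverage_mono {B : Finset ℕ} {f g : Finset ℕ → ℝ} (h : ∀ A ⊆ B, f A ≤ g A) :
    subsetAverage B f ≤ subsetAverage B g := by
  unfold subsetAverage
  gcongr with A hA
  exact h A (Finset.mem_powerset.1 hA)

theorem subsetAverage_add (B : Finset ℕ) (f g : Finset ℕ → ℝ) :
    subsetAverage B (fun A => f A + g A) = subsetAverage B f + subsetAverage B g := by
  simp [subsetAverage, Finset.sum_add_distrib, add_div]

theorem subsetAverage_const_mul (B : Finset ℕ) (c : ℝ) (f : Finset ℕ → ℝ) :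
    subsetAverage B (fun A => c * f A) = c * subsetAverage B f := by
  simp [subsetAverage, ← Finset.mul_sum, mul_div_assoc]

theorem subsetAverage_sum {α : Type*} (B : Finset ℕ) (J : Finset α) (f : α → Finset ℕ → ℝ) :
    subsetAverage B (fun A => ∑ j ∈ J, f j A) = ∑ j ∈ J, subsetAverage B (f j) := by
  simp only [subsetAverage]
  rw [Finset.sum_comm, Finset.sum_div]

theorem subsetAverage_const (B : Finset ℕ) (c : ℝ) : subsetAverage B (fun _ => c) = c := by
  simp [subsetAverage]

open Classical in
-- Condition on which elements of `C` are sampled: each of them only translates the interval, and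
-- the bound does not depend on `x`.
theorem subsetAverage_sum_mem_Ico_le (d : ℕ → ℝ) {η : ℝ} (I C : Finset ℕ)
    (hd : ∀ a ∈ I, η ≤ |d a|) (hIC : Disjoint C I) (x : ℝ) :
    subsetAverage (C ∪ I) (fun A => if ∑ a ∈ A, d a ∈ Set.Ico x (x + η) then 1 else 0)
      ≤ I.card.choose (I.card / 2) / 2 ^ I.card := by
  induction C using Finset.induction_on generalizing x with
  | empty =>
    simp only [subsetAverage, Finset.empty_union, Finset.sum_boole]
    gcongr
    exact card_powerset_sum_mem_Ico_le d I hd x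
  | insert b C hb ih =>
    rw [Finset.disjoint_insert_left] at hIC
    have hbn : b ∉ C ∪ I := by simp [hb, hIC.1]
    rw [Finset.insert_union, subsetAverage_insert hbn]
    have h1 := ih hIC.2 x
    have h2 := ih hIC.2 (x - d b)
    have h3 : subsetAverage (C ∪ I)
          (fun A => if ∑ a ∈ insert b A, d a ∈ Set.Ico x (x + η) then (1 : ℝ) else 0)
        ≤ subsetAverage (C ∪ I)
          (fun A => if ∑ a ∈ A, d a ∈ Set.Ico (x - d b) (x - d b + η) then 1 else 0) := by
      refine subsetAverage_mono fun A hA => le_of_eq (if_congr ?_ rfl rfl)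
      rw [Finset.sum_insert fun h => hbn (hA h)]
      simp only [Set.mem_Ico]
      constructor <;> rintro ⟨h1, h2⟩ <;> constructor <;> linarith
    linarith

open Classical in
/-- Anticoncentration of random subset sums on `[-c, c]`. -/
theorem subsetAverage_abs_sum_le (d : ℕ → ℝ) {η c : ℝ} (hη : 0 < η) (I B : Finset ℕ)
    (hd : ∀ a ∈ I, η ≤ |d a|) (hIB : I ⊆ B) :
    subsetAverage B (fun A => if |∑ a ∈ A, d a| ≤ c then 1 else 0)
      ≤ (⌊2 * c / η⌋₊ + 1 : ℕ) * (I.card.choose (I.card / 2) / 2 ^ I.card) := by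
  -- The interval [-c, c] is covered by ⌊2c/η⌋ + 1 half-open intervals of length `η`.
  calc _ ≤ subsetAverage B (fun A => ∑ j ∈ Finset.range (⌊2 * c / η⌋₊ + 1),
          if ∑ a ∈ A, d a ∈ Set.Ico (-c + j * η) (-c + j * η + η) then 1 else 0) := by
        refine subsetAverage_mono fun A _ => ?_
        split_ifs with h
        · set y := ∑ a ∈ A, d a
          obtain ⟨h1, h2⟩ := abs_le.1 h
          have hy : 0 ≤ (y + c) / η := div_nonneg (by linarith) hη.le
          have hj : ⌊(y + c) / η⌋₊ ∈ Finset.range (⌊2 * c / η⌋₊ + 1) := by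
            rw [Finset.mem_range, Nat.lt_succ_iff]
            exact Nat.floor_le_floor (by gcongr; linarith)
          refine le_trans ?_ (Finset.single_le_sum (fun j _ => by split_ifs <;> norm_num) hj)
          rw [if_pos]
          have h3 := Nat.floor_le hy
          have h4 := Nat.lt_floor_add_one ((y + c) / η)
          rw [le_div_iff₀ hη] at h3
          rw [div_lt_iff₀ hη] at h4
          constructor <;> linarith
        · exact Finset.sum_nonneg fun j _ => by split_ifs <;> norm_num
    _ ≤ _ := by
        rw [subsetAverage_sum, ← nsmul_eq_mul]
        refine (Finset.sum_le_card_nsmul _ _ _ fun j _ => ?_).trans_eq (by rw [Finset.card_range])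
        have := subsetAverage_sum_mem_Ico_le d I (B \ I) hd Finset.sdiff_disjoint (-c + j * η)
        rwa [Finset.sdiff_union_of_subset hIB] at this

/-! ### The regret against a fixed sequence of payoffs -/

/-- The number of earlier rounds satisfying `p` runs through 0, 1, 2, … as `t` runs through the
rounds satisfying `p`. -/
theorem sum_filter_comp_card_filter (p : ℕ → Prop) [DecidablePred p] (b : ℕ → ℝ) (T : ℕ) :
    ∑ t ∈ Finset.range T, (if p t then b ((Finset.range t).filter p).card else 0)
      = ∑ n ∈ Finset.range ((Finset.range T).filter p).card, b n := by
  induction T with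
  | zero => simp
  | succ T ih =>
    rw [Finset.sum_range_succ, ih, Finset.range_add_one, Finset.filter_insert]
    split_ifs with h
    · rw [Finset.card_insert_of_notMem (by simp), Finset.sum_range_succ]
    · simp

open Classical in
/-- The expected loss due to changes of the order of two alternatives grows sublinearly. -/
theorem sum_abs_mul_subsetAverage_le {c δ : ℝ} (hc : 0 ≤ c) (hδ : 0 < δ) :
    ∃ T₀ : ℕ, ∀ T ≥ T₀, ∀ d : ℕ → ℝ, (∀ t, |d t| ≤ c) →
      ∑ t ∈ Finset.range T, |d t| * subsetAverage (Finset.range t)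
        (fun A => if |∑ a ∈ A, d a| ≤ |d t| then 1 else 0) ≤ δ * T := by
  -- One half of `δ` pays for the rounds with |d t| ≤ η, the other for the Cesàro mean of `b`.
  set η := δ / 2
  have hη : 0 < η := by positivity
  set m : ℝ := ((⌊2 * c / η⌋₊ + 1 : ℕ) : ℝ)
  set b : ℕ → ℝ := fun n => c * (m * (n.choose (n / 2) / 2 ^ n))
  have hb0 (n : ℕ) : 0 ≤ b n := by positivity
  have hb : Tendsto b atTop (𝓝 0) := by
    simpa using (tendsto_choose_half_div_two_pow.const_mul m).const_mul c
  obtain ⟨T₀, hT₀⟩ := eventually_atTop.1 (hb.cesaro.eventually (gt_mem_nhds hη))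
  -- `b` involves only `c` and `δ`, so `T₀` is uniform in `d`.
  refine ⟨T₀, fun T hT d hd => ?_⟩
  have hp (t : ℕ) : subsetAverage (Finset.range t)
      (fun A => if |∑ a ∈ A, d a| ≤ |d t| then (1 : ℝ) else 0) ≤ 1 := by
    refine (subsetAverage_mono fun A _ => ?_).trans_eq (subsetAverage_const _ 1)
    split_ifs <;> norm_num
  have hterm (t : ℕ) : |d t| * subsetAverage (Finset.range t)
        (fun A => if |∑ a ∈ A, d a| ≤ |d t| then 1 else 0)
      ≤ η + if η < |d t| then b ((Finset.range t).filter fun τ => η < |d τ|).card else 0 := by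
    split_ifs with h
    · have h1 := subsetAverage_abs_sum_le (c := c) d hη
        ((Finset.range t).filter fun τ => η < |d τ|) (Finset.range t)
        (fun a ha => (Finset.mem_filter.1 ha).2.le) (Finset.filter_subset _ _)
      have h2 : subsetAverage (Finset.range t)
          (fun A => if |∑ a ∈ A, d a| ≤ |d t| then (1 : ℝ) else 0)
          ≤ subsetAverage (Finset.range t) (fun A => if |∑ a ∈ A, d a| ≤ c then 1 else 0) := by
        refine subsetAverage_mono fun A _ => ?_
        split_ifs with h3 h4
        · rfl
        · exact absurd (h3.trans (hd t)) h4
        · norm_num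
        · rfl
      have h3 := mul_le_mul (hd t) (h2.trans h1)
        (by unfold subsetAverage
            exact div_nonneg (Finset.sum_nonneg fun _ _ => by split_ifs <;> norm_num)
              (by positivity)) hc
      linarith
    · have := mul_le_mul_of_nonneg_left (hp t) (abs_nonneg (d t))
      linarith [not_lt.1 h]
  refine (Finset.sum_le_sum fun t _ => hterm t).trans ?_
  rw [Finset.sum_add_distrib, sum_filter_comp_card_filter]
  have h1 : ∑ n ∈ Finset.range ((Finset.range T).filter fun τ => η < |d τ|).card, b n
      ≤ ∑ n ∈ Finset.range T, b n := by
    refine Finset.sum_le_sum_of_subset_of_nonneg ?_ fun n _ _ => hb0 n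
    rw [Finset.range_subset_range]
    exact (Finset.card_filter_le _ _).trans_eq (Finset.card_range T)
  have h2 : ∑ n ∈ Finset.range T, b n ≤ η * T := by
    rcases Nat.eq_zero_or_pos T with rfl | hT'
    · simp
    · have := (hT₀ T hT).le
      rwa [inv_mul_le_iff₀ (by positivity), mul_comm] at this
  simp only [Finset.sum_const, Finset.card_range, nsmul_eq_mul]
  have : δ = 2 * η := by simp [η]; ring
  rw [this]
  linarith

open Classical in
/-- The set of maximizers of `X`. -/
noncomputable def argmaxes {K : Type*} [Fintype K] (X : K → ℝ) : Finset K := {k | ∀ k', X k' ≤ X k}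

/-- The mean of `g` over a uniformly random maximizer of `X`. -/
noncomputable def argmaxAverage {K : Type*} [Fintype K] (X g : K → ℝ) : ℝ :=
  (∑ k ∈ argmaxes X, g k) / (argmaxes X).card

theorem mem_argmaxes {K : Type*} [Fintype K] {X : K → ℝ} {k : K} :
    k ∈ argmaxes X ↔ ∀ k', X k' ≤ X k := by
  simp [argmaxes]

theorem argmaxes_nonempty {K : Type*} [Fintype K] [Nonempty K] (X : K → ℝ) :
    (argmaxes X).Nonempty := by
  obtain ⟨k, hk⟩ := Finite.exists_max X
  exact ⟨k, mem_argmaxes.2 hk⟩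

theorem le_argmaxAverage {K : Type*} [Fintype K] [Nonempty K] {X g : K → ℝ} {c : ℝ}
    (h : ∀ k ∈ argmaxes X, c ≤ g k) : c ≤ argmaxAverage X g := by
  have hc : (0 : ℝ) < (argmaxes X).card := by exact_mod_cast (argmaxes_nonempty X).card_pos
  rw [argmaxAverage, le_div_iff₀ hc, mul_comm, ← nsmul_eq_mul]
  exact Finset.card_nsmul_le_sum _ _ _ h

theorem argmaxAverage_le {K : Type*} [Fintype K] [Nonempty K] {X g : K → ℝ} {c : ℝ}
    (h : ∀ k ∈ argmaxes X, g k ≤ c) : argmaxAverage X g ≤ c := by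
  have hc : (0 : ℝ) < (argmaxes X).card := by exact_mod_cast (argmaxes_nonempty X).card_pos
  rw [argmaxAverage, div_le_iff₀ hc, mul_comm, ← nsmul_eq_mul]
  exact Finset.sum_le_card_nsmul _ _ _ h

theorem abs_argmaxAverage_le {K : Type*} [Fintype K] [Nonempty K] {X g : K → ℝ} {c : ℝ}
    (h : ∀ k, |g k| ≤ c) : |argmaxAverage X g| ≤ c :=
  abs_le.2 ⟨le_argmaxAverage fun k _ => (abs_le.1 (h k)).1,
    argmaxAverage_le fun k _ => (abs_le.1 (h k)).2⟩

/-- The maximal value of `X`. -/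
noncomputable def maxValue {K : Type*} [Fintype K] [Nonempty K] (X : K → ℝ) : ℝ :=
  Finset.univ.sup' Finset.univ_nonempty X

theorem le_maxValue {K : Type*} [Fintype K] [Nonempty K] (X : K → ℝ) (k : K) :
    X k ≤ maxValue X :=
  Finset.le_sup' X (Finset.mem_univ k)

open Classical in
-- Let `k` maximize `X` and `j` maximize `X + g`. Then max(X + g) ≤ X k + g k + (g j - g k), and
-- since `j` has caught up with `k`, the gap X k - X j is at most g j - g k. The excess is thus the
-- term of the pair (j, k). This holds for every maximizer `k`, hence for their average.
theorem maxValue_add_le {K : Type*} [Fintype K] [Nonempty K] (X g : K → ℝ) :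
    maxValue (fun k => X k + g k) ≤ maxValue X + argmaxAverage X g
      + ∑ p : K × K, |g p.1 - g p.2| * if |X p.1 - X p.2| ≤ |g p.1 - g p.2| then 1 else 0 := by
  suffices maxValue (fun k => X k + g k) - maxValue X
      - ∑ p : K × K, |g p.1 - g p.2| * (if |X p.1 - X p.2| ≤ |g p.1 - g p.2| then 1 else 0)
      ≤ argmaxAverage X g by linarith
  refine le_argmaxAverage fun k hk => ?_
  rw [mem_argmaxes] at hk
  obtain ⟨j, -, hj⟩ := Finset.exists_mem_eq_sup' Finset.univ_nonempty fun k => X k + g k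
  have h1 := le_maxValue (fun k => X k + g k) k
  have hj' : maxValue (fun k => X k + g k) = X j + g j := hj
  rw [hj'] at h1 ⊢
  have h2 : X j - X k ≤ 0 := sub_nonpos.2 (hk j)
  have h3 : 0 ≤ g j - g k := by linarith
  have h4 := Finset.single_le_sum (s := Finset.univ) (f := fun p : K × K =>
    |g p.1 - g p.2| * if |X p.1 - X p.2| ≤ |g p.1 - g p.2| then (1 : ℝ) else 0)
    (fun p _ => mul_nonneg (abs_nonneg _) (by split_ifs <;> norm_num)) (Finset.mem_univ (j, k))
  have h5 : |X j - X k| ≤ |g j - g k| := by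
    rw [abs_of_nonpos h2, abs_of_nonneg h3]
    linarith
  simp only [if_pos h5, mul_one] at h4
  rw [abs_of_nonneg h3] at h4
  linarith [le_maxValue X k]

/-- The expected payoff of sampled fictitious play in round `t` when the payoffs of the
alternatives are given by `g`. -/
noncomputable def sampledPayoff {K : Type*} [Fintype K] (g : ℕ → K → ℝ) (t : ℕ) : ℝ :=
  subsetAverage (Finset.range t) fun A => argmaxAverage (fun k => ∑ τ ∈ A, g τ k) (g t)

theorem subsetAverage_sum_eq (f : ℕ → ℝ) (T : ℕ) :
    subsetAverage (Finset.range T) (fun A => ∑ τ ∈ A, f τ) = (∑ τ ∈ Finset.range T, f τ) / 2 := by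
  induction T with
  | zero => simp [subsetAverage]
  | succ T ih =>
    rw [Finset.range_add_one, subsetAverage_insert (by simp), Finset.sum_insert (by simp), ih]
    have : subsetAverage (Finset.range T) (fun A => ∑ τ ∈ insert T A, f τ)
        = subsetAverage (Finset.range T) fun A => f T + ∑ τ ∈ A, f τ := by
      unfold subsetAverage
      congr 1
      refine Finset.sum_congr rfl fun A hA => Finset.sum_insert fun h => ?_
      simpa using Finset.mem_powerset.1 hA h
    rw [this, subsetAverage_add, subsetAverage_const, ih]
    ring

open Classical in
-- Growth of the potential. Half of the subsets of the first `T + 1` rounds contain round `T`, so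
-- the mean maximum gains half of the one-step increment, and the factor 2 restores it.
theorem subsetAverage_maxValue_le {K : Type*} [Fintype K] [Nonempty K] (g : ℕ → K → ℝ) (T : ℕ) :
    2 * subsetAverage (Finset.range T) (fun A => maxValue fun k => ∑ τ ∈ A, g τ k)
      ≤ ∑ t ∈ Finset.range T, sampledPayoff g t
        + ∑ p : K × K, ∑ t ∈ Finset.range T, |g t p.1 - g t p.2| * subsetAverage (Finset.range t)
          fun A => if |∑ τ ∈ A, (g τ p.1 - g τ p.2)| ≤ |g t p.1 - g t p.2| then 1 else 0 := by
  induction T with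
  | zero => simp [subsetAverage, maxValue]
  | succ T ih =>
    simp only [Finset.sum_range_succ, Finset.sum_add_distrib]
    rw [Finset.range_add_one, subsetAverage_insert (by simp)]
    have h : subsetAverage (Finset.range T) (fun A => maxValue fun k => ∑ τ ∈ insert T A, g τ k)
        ≤ subsetAverage (Finset.range T) (fun A => (maxValue fun k => ∑ τ ∈ A, g τ k)
          + argmaxAverage (fun k => ∑ τ ∈ A, g τ k) (g T)
          + ∑ p : K × K, |g T p.1 - g T p.2| *
            if |∑ τ ∈ A, (g τ p.1 - g τ p.2)| ≤ |g T p.1 - g T p.2| then 1 else 0) := by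
      refine subsetAverage_mono fun A hA => ?_
      have hT : T ∉ A := fun h => by simpa using hA h
      simp only [Finset.sum_insert hT, Finset.sum_sub_distrib]
      simp only [add_comm (g T _)]
      exact maxValue_add_le _ _
    rw [subsetAverage_add, subsetAverage_add, subsetAverage_sum] at h
    simp only [subsetAverage_const_mul] at h
    rw [sampledPayoff]
    linarith

/-- Against any fixed sequence of payoffs, sampled fictitious play has sublinear expected regret. -/
theorem maxValue_sub_sum_sampledPayoff_le {K : Type*} [Fintype K] [Nonempty K] {δ : ℝ}
    (hδ : 0 < δ) :
    ∃ T₀ : ℕ, ∀ T ≥ T₀, ∀ g : ℕ → K → ℝ, (∀ t k, |g t k| ≤ 1) →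
      (maxValue fun k => ∑ t ∈ Finset.range T, g t k) - ∑ t ∈ Finset.range T, sampledPayoff g t
        ≤ δ * T := by
  classical
  have hK : (0 : ℝ) < Fintype.card (K × K) := by exact_mod_cast Fintype.card_pos
  -- Differences of payoffs in [-1, 1] are at most 2, and `δ` is shared among the pairs of
  -- alternatives.
  obtain ⟨T₀, h⟩ := sum_abs_mul_subsetAverage_le (c := 2) (δ := δ / Fintype.card (K × K))
    zero_le_two (by positivity)
  refine ⟨T₀, fun T hT g hg => ?_⟩
  have h1 : (maxValue fun k => ∑ t ∈ Finset.range T, g t k)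
      ≤ 2 * subsetAverage (Finset.range T) (fun A => maxValue fun k => ∑ τ ∈ A, g τ k) := by
    refine Finset.sup'_le _ _ fun k _ => ?_
    have h2 : subsetAverage (Finset.range T) (fun A => ∑ τ ∈ A, g τ k)
        ≤ subsetAverage (Finset.range T) (fun A => maxValue fun k => ∑ τ ∈ A, g τ k) :=
      subsetAverage_mono fun A _ => le_maxValue (fun k => ∑ τ ∈ A, g τ k) k
    rw [subsetAverage_sum_eq] at h2
    linarith
  have h3 := Finset.sum_le_card_nsmul (Finset.univ : Finset (K × K)) _ _ fun p _ =>
    h T hT (fun t => g t p.1 - g t p.2) fun t => (abs_sub _ _).trans (by linarith [hg t p.1, hg t p.2])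
  rw [nsmul_eq_mul, Finset.card_univ] at h3
  have h4 : (Fintype.card (K × K) : ℝ) * (δ / Fintype.card (K × K) * T) = δ * T := by
    field_simp
  linarith [subsetAverage_maxValue_le g T]

theorem abs_sampledPayoff_le {K : Type*} [Fintype K] [Nonempty K] {g : ℕ → K → ℝ} {c : ℝ} {t : ℕ}
    (hg : ∀ k, |g t k| ≤ c) : |sampledPayoff g t| ≤ c := by
  rw [sampledPayoff, abs_le]
  constructor
  · refine (subsetAverage_const (Finset.range t) (-c)).symm.trans_le
      (subsetAverage_mono fun A _ => (abs_le.1 (abs_argmaxAverage_le hg)).1)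
  · exact (subsetAverage_mono fun A _ => (abs_le.1 (abs_argmaxAverage_le hg)).2).trans_eq
      (subsetAverage_const (Finset.range t) c)

/-! ### A law of large numbers for bounded martingale differences -/

section LawOfLargeNumbers

variable {Ω : Type*} {mΩ : MeasurableSpace Ω} {P : Measure Ω} [IsProbabilityMeasure P]
  {ℱ : Filtration ℕ mΩ} {Y : ℕ → Ω → ℝ} {c : ℝ}

theorem abs_sum_range_le (hc : ∀ t ω, |Y t ω| ≤ c) (T : ℕ) (ω : Ω) :
    |∑ t ∈ Finset.range T, Y t ω| ≤ T * c := by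
  refine (Finset.abs_sum_le_sum_abs _ _).trans ?_
  refine (Finset.sum_le_card_nsmul _ _ c fun t _ => hc t ω).trans_eq ?_
  rw [Finset.card_range, nsmul_eq_mul]

theorem integrable_of_abs_le {f : Ω → ℝ} (hf : Measurable f) (h : ∀ ω, |f ω| ≤ c) :
    Integrable f P :=
  .of_bound hf.aestronglyMeasurable c (ae_of_all _ h)

/-- Martingale differences are orthogonal: `Y T` has zero conditional mean given the earlier sum, so
the cross term vanishes. -/
theorem integral_sum_sq_le (hY : ∀ t, Measurable[ℱ (t + 1)] (Y t)) (hc : ∀ t ω, |Y t ω| ≤ c)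
    (h0 : ∀ t, P[Y t | ℱ t] =ᵐ[P] 0) (T : ℕ) :
    ∫ ω, (∑ t ∈ Finset.range T, Y t ω) ^ 2 ∂P ≤ T * c ^ 2 := by
  induction T with
  | zero => simp
  | succ T ih =>
    set S : Ω → ℝ := fun ω => ∑ t ∈ Finset.range T, Y t ω with hSdef
    have hYm (t : ℕ) : Measurable (Y t) := (hY t).mono (ℱ.le _) le_rfl
    have hSF : Measurable[ℱ T] S := Finset.measurable_fun_sum _ fun t ht =>
      (hY t).mono (ℱ.mono (Finset.mem_range.1 ht)) le_rfl
    have hS : Measurable S := hSF.mono (ℱ.le _) le_rfl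
    have hSb (ω : Ω) : |S ω| ≤ T * c := abs_sum_range_le hc T ω
    have hYint : Integrable (Y T) P := integrable_of_abs_le (hYm T) (hc T)
    have hcross : ∫ ω, S ω * Y T ω ∂P = 0 := by
      have h1 : P[S * Y T | ℱ T] =ᵐ[P] S * P[Y T | ℱ T] :=
        condExp_stronglyMeasurable_mul_of_bound (ℱ.le T) hSF.stronglyMeasurable hYint (T * c)
          (ae_of_all _ hSb)
      have h2 := integral_condExp (μ := P) (f := S * Y T) (ℱ.le T)
      rw [integral_congr_ae (h1.trans ((h0 T).mono fun ω h => show S ω * _ = (0 : ℝ) by simp [h])),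
        integral_zero] at h2
      exact h2.symm
    have hS2 : Integrable (fun ω => S ω ^ 2) P :=
      integrable_of_abs_le (c := (T * c) ^ 2) (hS.pow_const 2) fun ω => by
        rw [abs_pow]; exact pow_le_pow_left₀ (abs_nonneg _) (hSb ω) 2
    have hY2b (ω : Ω) : |Y T ω ^ 2| ≤ c ^ 2 := by
      rw [abs_pow]; exact pow_le_pow_left₀ (abs_nonneg _) (hc T ω) 2
    have hY2 : Integrable (fun ω => Y T ω ^ 2) P :=
      integrable_of_abs_le ((hYm T).pow_const 2) hY2b
    have hSY : Integrable (fun ω => S ω * Y T ω) P :=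
      hYint.bdd_mul hS.aestronglyMeasurable (ae_of_all _ hSb)
    have h3 : ∫ ω, Y T ω ^ 2 ∂P ≤ c ^ 2 := by
      refine (integral_mono hY2 (integrable_const (c ^ 2))
        fun ω => (le_abs_self _).trans (hY2b ω)).trans_eq (by simp)
    have h4 (ω : Ω) : (∑ t ∈ Finset.range (T + 1), Y t ω) ^ 2
        = S ω ^ 2 + (2 * (S ω * Y T ω) + Y T ω ^ 2) := by
      rw [Finset.sum_range_succ, hSdef]; ring
    simp only [h4]
    have hsum : Integrable (fun ω => 2 * (S ω * Y T ω) + Y T ω ^ 2) P := (hSY.const_mul 2).add hY2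
    rw [integral_add hS2 hsum, integral_add (hSY.const_mul 2) hY2,
      integral_const_mul, hcross]
    push_cast
    linarith

/-- Along squares the second moments of the averages are at most c²/(n+1)², which is summable; hence
the squared averages are almost surely summable. -/
theorem ae_tendsto_sum_div_sq (hY : ∀ t, Measurable[ℱ (t + 1)] (Y t))
    (hc : ∀ t ω, |Y t ω| ≤ c) (h0 : ∀ t, P[Y t | ℱ t] =ᵐ[P] 0) :
    ∀ᵐ ω ∂P, Tendsto (fun n : ℕ => (∑ t ∈ Finset.range ((n + 1) ^ 2), Y t ω)
      / ((n + 1) ^ 2 : ℕ)) atTop (𝓝 0) := by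
  set X : ℕ → Ω → ℝ := fun n ω => (∑ t ∈ Finset.range ((n + 1) ^ 2), Y t ω) / ((n + 1) ^ 2 : ℕ)
  have hX (n : ℕ) : Measurable (X n) := Measurable.div_const
    (Finset.measurable_fun_sum _ fun t _ => (hY t).mono (ℱ.le _) le_rfl) _
  have hXint (n : ℕ) : ∫⁻ ω, ENNReal.ofReal (X n ω ^ 2) ∂P
      ≤ ENNReal.ofReal (c ^ 2 * (1 / ((n + 1 : ℕ) : ℝ) ^ 2)) := by
    have hb (ω : Ω) : |X n ω ^ 2| ≤ c ^ 2 := by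
      rw [abs_pow]
      refine pow_le_pow_left₀ (abs_nonneg _) ?_ 2
      rw [abs_div, Nat.abs_cast, div_le_iff₀ (by positivity), mul_comm]
      exact abs_sum_range_le hc _ ω
    rw [← ofReal_integral_eq_lintegral_ofReal
      (integrable_of_abs_le ((hX n).pow_const 2) hb) (ae_of_all _ fun ω => sq_nonneg _)]
    refine ENNReal.ofReal_le_ofReal ?_
    simp only [X, div_pow]
    rw [integral_div, div_le_iff₀ (by positivity)]
    refine (integral_sum_sq_le hY hc h0 _).trans_eq ?_
    push_cast
    field_simp
  have hsum : Summable fun n : ℕ => c ^ 2 * (1 / ((n + 1 : ℕ) : ℝ) ^ 2) :=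
    (((summable_nat_add_iff 1).2 (Real.summable_one_div_nat_pow.2 one_lt_two))).mul_left _
  have hfin : ∫⁻ ω, ∑' n, ENNReal.ofReal (X n ω ^ 2) ∂P ≠ ⊤ := by
    rw [lintegral_tsum fun n => ((hX n).pow_const 2).ennreal_ofReal.aemeasurable]
    refine ne_top_of_le_ne_top ?_ (ENNReal.tsum_le_tsum hXint)
    exact hsum.tsum_ofReal_ne_top
  filter_upwards [ae_lt_top (.tsum fun n => ((hX n).pow_const 2).ennreal_ofReal) hfin] with ω hω
  have h1 := ENNReal.tendsto_atTop_zero_of_tsum_ne_top hω.ne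
  have h2 := (ENNReal.tendsto_toReal ENNReal.zero_ne_top).comp h1
  have h3 : Tendsto (fun n => X n ω ^ 2) atTop (𝓝 0) := by
    refine h2.congr fun n => ?_
    simp [ENNReal.toReal_ofReal (sq_nonneg (X n ω))]
  have h4 := h3.sqrt
  simp only [Real.sqrt_sq_eq_abs, Real.sqrt_zero] at h4
  exact (tendsto_zero_iff_abs_tendsto_zero _).2 h4

/-- The averages of bounded martingale differences converge to zero almost surely. -/
theorem ae_tendsto_sum_div (hY : ∀ t, Measurable[ℱ (t + 1)] (Y t))
    (hc : ∀ t ω, |Y t ω| ≤ c) (h0 : ∀ t, P[Y t | ℱ t] =ᵐ[P] 0) :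
    ∀ᵐ ω ∂P, Tendsto (fun T : ℕ => (∑ t ∈ Finset.range T, Y t ω) / T) atTop (𝓝 0) := by
  filter_upwards [ae_tendsto_sum_div_sq hY hc h0] with ω hω
  -- Adding `c` makes the partial sums monotone, so convergence along squares, whose consecutive
  -- ratios tend to 1, gives convergence along all `T`.
  have hmono : Monotone fun T : ℕ => ∑ t ∈ Finset.range T, (Y t ω + c) :=
    monotone_nat_of_le_succ fun T => by
      rw [Finset.sum_range_succ]
      linarith [(abs_le.1 (hc T ω)).1]
  have hdiv (T : ℕ) (hT : T ≠ 0) : (∑ t ∈ Finset.range T, (Y t ω + c)) / T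
      = (∑ t ∈ Finset.range T, Y t ω) / T + c := by
    have : (T : ℝ) ≠ 0 := by exact_mod_cast hT
    rw [Finset.sum_add_distrib, add_div]
    simp [this]
  have key := tendsto_div_of_monotone_of_exists_subseq_tendsto_div _ c hmono fun a ha => by
    refine ⟨fun n => (n + 1) ^ 2, ?_, ?_, ?_⟩
    · have h1 : Tendsto (fun n : ℕ => (1 + 1 / ((n : ℝ) + 1)) ^ 2) atTop (𝓝 1) := by
        simpa using ((tendsto_one_div_add_atTop_nhds_zero_nat (𝕜 := ℝ)).const_add 1).pow 2
      filter_upwards [h1.eventually (gt_mem_nhds ha)] with n hn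
      have h2 : (1 + 1 / ((n : ℝ) + 1)) ^ 2 * ((n : ℝ) + 1) ^ 2 = ((n : ℝ) + 1 + 1) ^ 2 := by
        field_simp
      push_cast
      rw [← h2]
      gcongr
    · exact (tendsto_pow_atTop two_ne_zero).comp (tendsto_add_atTop_nat 1)
    · refine Tendsto.congr (fun n => (hdiv _ (by positivity)).symm) ?_
      simpa using hω.add_const c
  have h5 := key.sub_const c
  rw [sub_self] at h5
  refine h5.congr' ?_
  filter_upwards [eventually_ne_atTop 0] with T hT
  rw [hdiv T hT, add_sub_cancel_right]

end LawOfLargeNumbers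

/-! ### The conditional expectation of the payoff -/

theorem IsSampledFictitiousPlay.signAlgebra_le {ι : Type*} [DecidableEq ι] {S : ι → Type*}
    {Ω : Type*} {mΩ : MeasurableSpace Ω} {P : Measure Ω} {v : (∀ j, S j) → ℝ} {i : ι}
    [Fintype (S i)] {ℱ : Filtration ℕ mΩ} {ε : ℕ → ℕ → Ω → ℤ} {s : ℕ → Ω → ∀ j, S j}
    (h : IsSampledFictitiousPlay P v i ℱ ε s) (t : ℕ) : signAlgebra ε t ≤ mΩ :=
  iSup_le fun τ => (h.measurable_sign t τ τ.2).comap_le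

section Play

variable {ι : Type*} {S : ι → Type*} [∀ j, Fintype (S j)]
  {Ω : Type*} {mΩ : MeasurableSpace Ω} {P : Measure Ω}
  {v : (∀ j, S j) → ℝ} {i : ι} {ℱ : Filtration ℕ mΩ} {ε : ℕ → ℕ → Ω → ℤ} {s : ℕ → Ω → ∀ j, S j}

theorem setOf_sampledSet_eq {t : ℕ} {A : Finset ℕ} (hA : A ⊆ Finset.range t) :
    {ω | sampledSet t (fun τ => ε t τ ω) = A}
      = ⋂ τ ∈ (Finset.univ : Finset (Fin t)), ε t τ ⁻¹' {n | n = 1 ↔ (τ : ℕ) ∈ A} := by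
  ext ω
  simp only [sampledSet, Set.mem_ofPred_eq, Finset.ext_iff, Finset.mem_filter, Finset.mem_range,
    Finset.mem_univ, Set.iInter_true, Set.mem_iInter, Set.mem_preimage]
  constructor
  · intro h τ
    simpa using h τ
  · intro h τ
    by_cases hτ : τ < t
    · simpa [hτ] using h ⟨τ, hτ⟩
    · simp only [hτ, false_and, false_iff]
      exact fun h' => hτ (Finset.mem_range.1 (hA h'))

theorem measurableSet_sampledSet {t : ℕ} {A : Finset ℕ} (hA : A ⊆ Finset.range t) :
    MeasurableSet[signAlgebra ε t] {ω | sampledSet t (fun τ => ε t τ ω) = A} := by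
  rw [setOf_sampledSet_eq hA]
  refine Finset.measurableSet_biInter _ fun τ _ => ?_
  exact le_iSup (fun τ : Fin t => MeasurableSpace.comap (ε t τ) inferInstance) τ _
    ⟨_, .of_discrete, rfl⟩

theorem IsSampledFictitiousPlay.measure_sampledSet [DecidableEq ι] [IsProbabilityMeasure P]
    (h : IsSampledFictitiousPlay P v i ℱ ε s) {t : ℕ} {A : Finset ℕ} (hA : A ⊆ Finset.range t) :
    P.real {ω | sampledSet t (fun τ => ε t τ ω) = A} = 1 / 2 ^ t := by
  have h1 (τ : Fin t) : P (ε t τ ⁻¹' {n | n = 1 ↔ (τ : ℕ) ∈ A}) = 1 / 2 := by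
    have h2 := (h.sign_law t τ τ.2).1
    by_cases hτ : (τ : ℕ) ∈ A
    · rw [← h2]
      congr 1
      ext ω
      simp [hτ]
    · have h3 : ε t τ ⁻¹' {n | n = 1 ↔ (τ : ℕ) ∈ A} = {ω | ε t τ ω = 1}ᶜ := by
        ext ω; simp [hτ]
      rw [h3, prob_compl_eq_one_sub
        (measurableSet_eq_fun (h.measurable_sign t τ τ.2) measurable_const), h2]
      simp
  rw [setOf_sampledSet_eq hA, measureReal_def,
    (h.sign_indep t).measure_inter_preimage_eq_mul Finset.univ fun _ _ => .of_discrete,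
    Finset.prod_congr rfl fun τ _ => h1 τ]
  simp

theorem IsSampledFictitiousPlay.condExp_sampledSet [DecidableEq ι] [IsProbabilityMeasure P]
    (h : IsSampledFictitiousPlay P v i ℱ ε s) {t : ℕ} {A : Finset ℕ} (hA : A ⊆ Finset.range t) :
    P⟦{ω | sampledSet t (fun τ => ε t τ ω) = A} | ℱ t⟧ =ᵐ[P] fun _ => 1 / 2 ^ t := by
  have h1 := condExp_indep_eq (μ := P) (h.signAlgebra_le t) (ℱ.le t)
    (stronglyMeasurable_const.indicator (measurableSet_sampledSet hA) :
      StronglyMeasurable[signAlgebra ε t]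
        ({ω | sampledSet t (fun τ => ε t τ ω) = A}.indicator fun _ => (1 : ℝ)))
    (h.sign_fresh t)
  rw [integral_indicator_const _ (h.signAlgebra_le t _ (measurableSet_sampledSet hA)),
    h.measure_sampledSet hA, smul_eq_mul, mul_one] at h1
  exact h1

variable [Fintype ι]

theorem measurable_comp_of_finite {α : Type*} [Finite α] {m : MeasurableSpace Ω} {f : Ω → α}
    (hf : ∀ a, MeasurableSet[m] {ω | f ω = a}) (φ : α → ℝ) : Measurable[m] fun ω => φ (f ω) := by
  let : MeasurableSpace α := ⊤
  have h : Measurable[m] f := measurable_to_countable' fun a => hf a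
  exact (measurable_from_top (f := φ)).comp h

theorem IsAdaptivePlay.measurable_payoff (hs : IsAdaptivePlay i ℱ s) (φ : (∀ j, S j) → ℝ) (t : ℕ) :
    Measurable[ℱ (t + 1)] fun ω => φ (s t ω) :=
  measurable_comp_of_finite (fun a => hs.past (t + 1) t t.lt_succ_self a) φ

theorem IsAdaptivePlay.measurableSet_own (hs : IsAdaptivePlay i ℱ s) (t : ℕ) (k : S i) :
    MeasurableSet {ω | s t ω i = k} := by
  classical
  have h := hs.measurable_payoff (fun a => if a i = k then 1 else 0) t
  have h2 : {ω | s t ω i = k} = (fun ω => if s t ω i = k then (1 : ℝ) else 0) ⁻¹' {1} := by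
    ext ω; simp
  rw [h2]
  exact ℱ.le _ _ (h (measurableSet_singleton 1))

variable [DecidableEq ι]

/-- Overwriting coordinate `i` leaves only the opponents' moves, which are already known in `ℱ t`;
the full profile is known only in `ℱ (t + 1)`. -/
theorem IsAdaptivePlay.measurable_update (hs : IsAdaptivePlay i ℱ s) (φ : (∀ j, S j) → ℝ) (t : ℕ)
    (k : S i) : Measurable[ℱ t] fun ω => φ (Function.update (s t ω) i k) := by
  refine measurable_comp_of_finite (fun a => ?_) φ
  by_cases ha : a i = k
  · have : {ω | Function.update (s t ω) i k = a} = ⋂ j, ⋂ (_ : j ≠ i), {ω | s t ω j = a j} := by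
      ext ω
      simp only [Function.update_eq_iff, ha, true_and, Set.mem_ofPred_eq, Set.mem_iInter]
    rw [this]
    exact .iInter fun j => .iInter fun hj => hs.opponents t j hj (a j)
  · have : {ω | Function.update (s t ω) i k = a} = ∅ := by
      ext ω
      simp only [Set.mem_ofPred_eq, Set.mem_empty_iff_false, iff_false]
      rintro rfl
      simp at ha
    rw [this]
    exact @MeasurableSet.empty _ (ℱ t)

theorem measurable_argmaxAverage {K : Type*} [Fintype K] {m : MeasurableSpace Ω} {X g : Ω → K → ℝ}
    (hX : ∀ k, Measurable[m] fun ω => X ω k) (hg : ∀ k, Measurable[m] fun ω => g ω k) :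
    Measurable[m] fun ω => argmaxAverage (X ω) (g ω) := by
  classical
  have h (k : K) : MeasurableSet[m] {ω | k ∈ argmaxes (X ω)} := by
    simp only [mem_argmaxes, Set.ofPred_forall]
    exact .iInter fun k' => measurableSet_le (hX k') (hX k)
  have h2 (ω : Ω) : argmaxAverage (X ω) (g ω) = (∑ k, if k ∈ argmaxes (X ω) then g ω k else 0)
      / ∑ k, if k ∈ argmaxes (X ω) then 1 else 0 := by
    simp [argmaxAverage, Finset.sum_ite_mem]
  simp only [h2]
  exact (Finset.measurable_fun_sum _ fun k _ => .ite (h k) (hg k) measurable_const).div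
    (Finset.measurable_fun_sum _ fun k _ => .ite (h k) measurable_const measurable_const)

variable [IsProbabilityMeasure P]

theorem IsSampledFictitiousPlay.condExp_payoff_sup [Nonempty (S i)]
    (hs : IsAdaptivePlay i ℱ s) (h : IsSampledFictitiousPlay P v i ℱ ε s)
    (hv : ∀ a, |v a| ≤ 1) (t : ℕ) :
    P[fun ω => v (s t ω) | ℱ t ⊔ signAlgebra ε t] =ᵐ[P] fun ω =>
      argmaxAverage (cumPayoff v i (fun τ => s τ ω) (sampledSet t fun τ => ε t τ ω))
        fun k => v (Function.update (s t ω) i k) := by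
  classical
  have hle : ℱ t ⊔ signAlgebra ε t ≤ mΩ := sup_le (ℱ.le t) (h.signAlgebra_le t)
  set B : S i → Ω → ℝ := fun k => {ω | s t ω i = k}.indicator fun _ => 1
  set g : S i → Ω → ℝ := fun k ω => v (Function.update (s t ω) i k)
  have hB (k : S i) : Integrable (B k) P :=
    (integrable_const (1 : ℝ)).indicator (hs.measurableSet_own t k)
  have hg (k : S i) : Measurable[ℱ t ⊔ signAlgebra ε t] (g k) :=
    (hs.measurable_update v t k).mono le_sup_left le_rfl
  have hgb (k : S i) : ∀ᵐ ω ∂P, ‖g k ω‖ ≤ 1 := ae_of_all _ fun ω => hv _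
  -- Split by the player's own move: `g k` is known and factors out, leaving the conditional law of
  -- that move.
  have hdec : (fun ω => v (s t ω)) = ∑ k, g k * B k := by
    ext ω
    simp only [g, B, Finset.sum_apply, Pi.mul_apply, Set.indicator_apply, Set.mem_ofPred_eq,
      mul_ite, mul_one, mul_zero]
    simp
  have hgB (k : S i) : Integrable (g k * B k) P :=
    (hB k).bdd_mul ((hg k).mono hle le_rfl).aestronglyMeasurable (hgb k)
  rw [hdec]
  have hk : ∀ᵐ ω ∂P, ∀ k, (P[g k * B k | ℱ t ⊔ signAlgebra ε t] ω = g k ω *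
      Set.indicator
        (bestResponses v i (fun τ => s τ ω) (sampledSet t fun τ => ε t τ ω) : Set (S i))
        (fun _ => 1 /
          ((bestResponses v i (fun τ => s τ ω) (sampledSet t fun τ => ε t τ ω)).card : ℝ)) k) := by
    rw [ae_all_iff]
    intro k
    filter_upwards [condExp_stronglyMeasurable_mul_of_bound hle (hg k).stronglyMeasurable (hB k) 1
      (hgb k), h.best_response t k] with ω h1 h2
    rw [h1, Pi.mul_apply, h2]
  filter_upwards [condExp_finsetSum (μ := P) (s := Finset.univ) (fun k _ => hgB k)
    (ℱ t ⊔ signAlgebra ε t), hk] with ω h1 h2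
  rw [h1, Finset.sum_apply, Finset.sum_congr rfl fun k _ => h2 k]
  have h3 : bestResponses v i (fun τ => s τ ω) (sampledSet t fun τ => ε t τ ω)
      = argmaxes (cumPayoff v i (fun τ => s τ ω) (sampledSet t fun τ => ε t τ ω)) := rfl
  rw [h3, argmaxAverage, Finset.sum_div]
  simp only [Set.indicator_apply, Finset.mem_coe, mul_ite, mul_zero, mul_one_div]
  rw [Finset.sum_ite_mem, Finset.univ_inter]

theorem IsSampledFictitiousPlay.condExp_payoff [Nonempty (S i)]
    (hs : IsAdaptivePlay i ℱ s) (h : IsSampledFictitiousPlay P v i ℱ ε s)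
    (hv : ∀ a, |v a| ≤ 1) (t : ℕ) :
    P[fun ω => v (s t ω) | ℱ t] =ᵐ[P] fun ω =>
      sampledPayoff (fun τ k => v (Function.update (s τ ω) i k)) t := by
  classical
  have hle : ℱ t ⊔ signAlgebra ε t ≤ mΩ := sup_le (ℱ.le t) (h.signAlgebra_le t)
  set g : ℕ → S i → Ω → ℝ := fun τ k ω => v (Function.update (s τ ω) i k)
  set M : Finset ℕ → Ω → ℝ := fun A ω =>
    argmaxAverage (fun k => ∑ τ ∈ A, g τ k ω) fun k => g t k ω
  set B : Finset ℕ → Ω → ℝ := fun A =>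
    {ω | sampledSet t (fun τ => ε t τ ω) = A}.indicator fun _ => 1
  have hg {τ : ℕ} (hτ : τ ≤ t) (k : S i) : Measurable[ℱ t] (g τ k) :=
    (hs.measurable_update v τ k).mono (ℱ.mono hτ) le_rfl
  have hM {A : Finset ℕ} (hA : A ∈ (Finset.range t).powerset) : Measurable[ℱ t] (M A) :=
    measurable_argmaxAverage (fun k => Finset.measurable_fun_sum _ fun τ hτ =>
      hg (Finset.mem_range.1 (Finset.mem_powerset.1 hA hτ)).le k) fun k => hg le_rfl k
  have hMb (A : Finset ℕ) : ∀ᵐ ω ∂P, ‖M A ω‖ ≤ 1 :=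
    ae_of_all _ fun ω => abs_argmaxAverage_le fun k => hv _
  have hB {A : Finset ℕ} (hA : A ∈ (Finset.range t).powerset) : Integrable (B A) P :=
    (integrable_const (1 : ℝ)).indicator
      (h.signAlgebra_le t _ (measurableSet_sampledSet (Finset.mem_powerset.1 hA)))
  have hMB (A : Finset ℕ) (hA : A ∈ (Finset.range t).powerset) : Integrable (M A * B A) P :=
    (hB hA).bdd_mul ((hM hA).mono (ℱ.le t) le_rfl).aestronglyMeasurable (hMb A)
  -- Split by the sampled set: `M A` is `ℱ t`-measurable, and by freshness of the signs each `A` has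
  -- conditional probability 2⁻ᵗ.
  have hdec : (fun ω =>
      argmaxAverage (cumPayoff v i (fun τ => s τ ω) (sampledSet t fun τ => ε t τ ω))
        fun k => v (Function.update (s t ω) i k)) = ∑ A ∈ (Finset.range t).powerset, M A * B A := by
    ext ω
    have hmem : sampledSet t (fun τ => ε t τ ω) ∈ (Finset.range t).powerset :=
      Finset.mem_powerset.2 (Finset.filter_subset _ _)
    simp only [B, Finset.sum_apply, Pi.mul_apply, Set.indicator_apply, Set.mem_ofPred_eq,
      mul_ite, mul_one, mul_zero]
    rw [Finset.sum_ite_eq, if_pos hmem]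
    rfl
  have hA : ∀ᵐ ω ∂P, ∀ A ∈ (Finset.range t).powerset,
      P[M A * B A | ℱ t] ω = M A ω * (1 / 2 ^ t) := by
    rw [Finset.eventually_all]
    intro A hA
    filter_upwards [condExp_stronglyMeasurable_mul_of_bound (ℱ.le t) (hM hA).stronglyMeasurable
      (hB hA) 1 (hMb A), h.condExp_sampledSet (Finset.mem_powerset.1 hA)] with ω h1 h2
    rw [h1, Pi.mul_apply, h2]
  have htower := condExp_condExp_of_le (μ := P) (f := fun ω => v (s t ω))
    (le_sup_left : ℱ t ≤ ℱ t ⊔ signAlgebra ε t) hle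
  have hcongr := condExp_congr_ae (m := ℱ t) (h.condExp_payoff_sup hs hv t)
  rw [hdec] at hcongr
  filter_upwards [htower, hcongr, condExp_finsetSum (μ := P) hMB (ℱ t), hA] with ω h1 h2 h3 h4
  rw [← h1, h2, h3, Finset.sum_apply, Finset.sum_congr rfl h4, ← Finset.sum_mul, mul_one_div,
    sampledPayoff, subsetAverage, Finset.card_range]

theorem measurable_sampledPayoff (hs : IsAdaptivePlay i ℱ s) (v : (∀ j, S j) → ℝ) (t : ℕ) :
    Measurable[ℱ t] fun ω => sampledPayoff (fun τ k => v (Function.update (s τ ω) i k)) t := by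
  have hg {τ : ℕ} (hτ : τ ≤ t) (k : S i) :
      Measurable[ℱ t] fun ω => v (Function.update (s τ ω) i k) :=
    (hs.measurable_update v τ k).mono (ℱ.mono hτ) le_rfl
  refine Measurable.div_const (Finset.measurable_fun_sum _ fun A hA => ?_) _
  exact measurable_argmaxAverage (fun k => Finset.measurable_fun_sum _ fun τ hτ =>
    hg (Finset.mem_range.1 (Finset.mem_powerset.1 hA hτ)).le k) fun k => hg le_rfl k

end Play

/-! ### From expected regret to almost sure regret -/

theorem hasNoRegret_of_sampledFictitiousPlay {ι : Type*} [Fintype ι] [DecidableEq ι]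
    {S : ι → Type*} [∀ j, Fintype (S j)] {v : (∀ j, S j) → ℝ} {i : ι} [Nonempty (S i)]
    (hv : ∀ a, |v a| ≤ 1) {Ω : Type*} {mΩ : MeasurableSpace Ω} {P : Measure Ω}
    [IsProbabilityMeasure P] {ℱ : Filtration ℕ mΩ} {ε : ℕ → ℕ → Ω → ℤ} {s : ℕ → Ω → ∀ j, S j}
    (hs : IsAdaptivePlay i ℱ s) (h : IsSampledFictitiousPlay P v i ℱ ε s) :
    HasNoRegret P v i s := by
  set W : ℕ → Ω → ℝ := fun t ω => sampledPayoff (fun τ k => v (Function.update (s τ ω) i k)) t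
  set Y : ℕ → Ω → ℝ := fun t ω => v (s t ω) - W t ω
  have hW (t : ℕ) : Measurable[ℱ t] (W t) := measurable_sampledPayoff hs v t
  have hWb (t : ℕ) (ω : Ω) : |W t ω| ≤ 1 := abs_sampledPayoff_le fun k => hv _
  have hvm (t : ℕ) : Measurable[ℱ (t + 1)] fun ω => v (s t ω) := hs.measurable_payoff v t
  have hY (t : ℕ) : Measurable[ℱ (t + 1)] (Y t) :=
    (hvm t).sub ((hW t).mono (ℱ.mono t.le_succ) le_rfl)
  have hYb (t : ℕ) (ω : Ω) : |Y t ω| ≤ 2 :=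
    (abs_sub _ _).trans (by linarith [hv (s t ω), hWb t ω])
  have hY0 (t : ℕ) : P[Y t | ℱ t] =ᵐ[P] 0 := by
    have hWint : Integrable (W t) P :=
      integrable_of_abs_le ((hW t).mono (ℱ.le t) le_rfl) (hWb t)
    have hvint : Integrable (fun ω => v (s t ω)) P :=
      integrable_of_abs_le ((hvm t).mono (ℱ.le _) le_rfl) fun ω => hv _
    filter_upwards [condExp_sub hvint hWint (ℱ t), h.condExp_payoff hs hv t] with ω h1 h2
    have h3 := condExp_of_stronglyMeasurable (μ := P) (ℱ.le t) (hW t).stronglyMeasurable hWint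
    have h4 : P[Y t | ℱ t] ω = _ := h1
    rw [h4, Pi.sub_apply, h2, h3, sub_self, Pi.zero_apply]
  filter_upwards [ae_tendsto_sum_div hY hYb hY0] with ω hω
  -- A real `limsup` is bounded from above by an eventual bound only if the sequence is not
  -- unbounded below; at `T = 0` the quotient is 0 by convention.
  have hbelow (T : ℕ) : -2 ≤ regret v i (fun τ => s τ ω) T / (T : ℝ) := by
    rcases T.eq_zero_or_pos with rfl | hT
    · simp
    · rw [le_div_iff₀ (by positivity)]
      have h1 : -(T * 1 : ℝ) ≤ ∑ τ ∈ Finset.range T,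
          v (Function.update (s τ ω) i (Classical.arbitrary (S i))) :=
        (abs_le.1 (abs_sum_range_le (Y := fun τ ω =>
          v (Function.update (s τ ω) i (Classical.arbitrary (S i)))) (fun _ _ => hv _) T ω)).1
      have h2 : ∑ τ ∈ Finset.range T, v (s τ ω) ≤ T * 1 :=
        (abs_le.1 (abs_sum_range_le (Y := fun τ ω => v (s τ ω)) (fun _ _ => hv _) T ω)).2
      have h3 := le_maxValue (cumPayoff v i (fun τ => s τ ω) (Finset.range T))
        (Classical.arbitrary (S i))
      simp only [regret]
      change _ ≤ maxValue (cumPayoff v i (fun τ => s τ ω) (Finset.range T)) - _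
      simp only [cumPayoff] at h3 ⊢
      linarith
  refine le_of_forall_pos_le_add fun δ hδ => ?_
  rw [zero_add]
  refine limsup_le_of_le (isCoboundedUnder_le_of_le atTop hbelow) ?_
  -- Half of `δ` bounds the expected regret on the realized path, the other half the martingale
  -- average.
  obtain ⟨T₀, hT₀⟩ := maxValue_sub_sum_sampledPayoff_le (K := S i) (half_pos hδ)
  filter_upwards [eventually_ge_atTop T₀, eventually_gt_atTop 0,
    hω.eventually (lt_mem_nhds (neg_lt_zero.2 (half_pos hδ)))] with T hT hT1 hT2
  have hTpos : (0 : ℝ) < T := by exact_mod_cast hT1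
  have h1 := hT₀ T hT (fun τ k => v (Function.update (s τ ω) i k)) fun _ _ => hv _
  rw [lt_div_iff₀ hTpos] at hT2
  rw [div_le_iff₀ hTpos]
  have h2 : ∑ t ∈ Finset.range T, Y t ω
      = ∑ t ∈ Finset.range T, v (s t ω) - ∑ t ∈ Finset.range T, W t ω := Finset.sum_sub_distrib ..
  change maxValue (fun k => ∑ τ ∈ Finset.range T, v (Function.update (s τ ω) i k)) - _ ≤ _
  change _ - ∑ t ∈ Finset.range T, W t ω ≤ _ at h1
  linarith

end RepeatedGame

theorem theorem1 {ι : Type*} [Fintype ι] [DecidableEq ι] {S : ι → Type*} [∀ j, Fintype (S j)]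
    [∀ j, Nonempty (S j)] (u : ι → (∀ j, S j) → ℝ) (i : ι)
    (hu : ∀ a : ∀ j, S j, u i a ∈ Set.Icc (-1 : ℝ) 1)
    {Ω : Type*} {mΩ : MeasurableSpace Ω} (P : Measure Ω) [IsProbabilityMeasure P]
    (ℱ : Filtration ℕ mΩ) (ε : ℕ → ℕ → Ω → ℤ) (s : ℕ → Ω → ∀ j, S j)
    (hs : RepeatedGame.IsAdaptivePlay i ℱ s)
    (hsfp : RepeatedGame.IsSampledFictitiousPlay P (u i) i ℱ ε s) :
    RepeatedGame.HasNoRegret P (u i) i s :=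
  RepeatedGame.hasNoRegret_of_sampledFictitiousPlay (fun a => abs_le.2 (hu a)) hs hsfp
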